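/- \textbf{Setting.} Let $0<r_1<m$ and $0<r_2<n$ be integers, and let $\Lambda\in\mathbb R^{m\times m}$, $\Psi\in\mathbb R^{n\times n}$ be such that $1$ is a semisimple eigenvalue of $\Lambda$ of algebraic multiplicity $m-r_1$ and a semisimple eigenvalue of $\Psi$ of algebraic multiplicity $n-r_2$, while every other complex eigenvalue of $\Lambda$ and of $\Psi$ has modulus strictly less than $1$. Let $\Lambda=I_m+\tau\gamma'$ and $\Psi=I_n+\varphi\theta'$ with $\tau,\gamma\in\mathbb R^{m\times r_1}$ and $\varphi,\theta\in\mathbb R^{n\times r_2}$ of full column rank. Let $(E_t)_{t\in\mathbb Z}$ be an $m\times n$ matrix white noise on a probability space (square integrable, mean zero, $\operatorname{Cov}(\operatorname{vec}E_t)$ independent of $t$, no correlation between different dates). Consider the matrix autoregression $X_t=\Lambda X_{t-1}\Psi'+E_t$ in its error-correction form $$\Delta X_t=\tau\gamma'X_{t-1}+X_{t-1}\theta\varphi'+\tau\gamma'X_{t-1}\theta\varphi'+E_t .\qquad(*)$$ A matrix process $(Y_t)_{t\in\mathbb Z}$ is called $I(0)$ (with innovations $E$) if $y_t=\operatorname{vec}Y_t$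 is weakly stationary and $y_t-\mathbb E y_t=\sum_{i\ge 0}C_i\operatorname{vec}(E_{t-i})$ almost surely for every $t$, with deterministic matrices $C_i$ that decrease exponentially in $i$ and such that every row of $\sum_{i\ge0}C_i$ is nonzero. \textbf{Theorem.} (1) Let $(X_t)_{t\in\mathbb Z}$ satisfy $(*)$ almost surely for each $t\in\mathbb Z$ and suppose that almost surely it does not grow exponentially in the past, i.e. almost surely each entry of $X_{-k}$ is $O(r^k)$ as $k\to\infty$ for every $r>1$. Then the row equilibrium error $\gamma'X_t$ and the column equilibrium error $X_t\theta$ are both $I(0)$. (2) There are $I(0)$ processes $(Y_t)_{t\in\mathbb Z}$ in $\mathbb R^{r_1\times n}$ and $(Z_t)_{t\in\mathbb Z}$ in $\mathbb R^{m\times r_2}$ and a number $\rho\in[0,1)$ such that, for every process $(X_t)_{t\ge0}$ that satisfies $(*)$ almost surely for each $t\ge1$, with arbitrary initial value $X_0$: almost surely there is a finite $K$ such that every entry of $\gamma'X_t-Y_t$ is bounded in absolute value by $K\rho^t$ for all $t\ge0$, and likewise for $X_t\theta-Z_t$. Moreover, if $\gamma'X_0=Y_0$ almost surely, then $\gamma'X_t=Y_t$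 almost surely for every $t\ge0$; and if $X_0\theta=Z_0$ almost surely, then $X_t\theta=Z_t$ almost surely for every $t\ge0$. -/

import Mathlib

open MeasureTheory ProbabilityTheory Filter Matrix

/-- A real square matrix `A` of size `p` that has the eigenvalue `1`, semisimple (geometric
multiplicity = algebraic multiplicity) and of algebraic multiplicity `p - r` with `0 < r < p`,
while all its other (complex) eigenvalues lie strictly inside the unit disk. -/
structure HasSemisimpleUnitRoots {p : ℕ} (A : Matrix (Fin p) (Fin p) ℝ) (r : ℕ) : Prop where
  pos : 0 < r
  lt : r < p
  algebraic_multiplicity : A.charpoly.rootMultiplicity 1 = p - r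
  semisimple : Module.finrank ℝ (Module.End.eigenspace (Matrix.toLin' A) 1) = p - r
  stable : ∀ z : ℂ, Module.End.HasEigenvalue (Matrix.toLin' (A.map Complex.ofReal)) z →
    z ≠ 1 → ‖z‖ < 1

/-- (Weak) vector white noise: square integrable, centred, with constant covariance matrix and
no correlation between different dates. -/
structure IsWhiteNoise {Ω : Type*} [MeasurableSpace Ω] (P : Measure Ω) {κ : Type*}
    (ε : ℤ → Ω → κ → ℝ) : Prop where
  memLp : ∀ t k, MemLp (fun ω => ε t ω k) 2 P
  mean_zero : ∀ t k, ∫ ω, ε t ω k ∂P = 0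
  covariance_const : ∀ s t k l,
    covariance (fun ω => ε s ω k) (fun ω => ε s ω l) P
      = covariance (fun ω => ε t ω k) (fun ω => ε t ω l) P
  uncorrelated : ∀ s t k l, s ≠ t →
    covariance (fun ω => ε s ω k) (fun ω => ε t ω l) P = 0

/-- (Weak) stationarity of a vector process. -/
structure IsWeaklyStationary {Ω : Type*} [MeasurableSpace Ω] (P : Measure Ω) {ι : Type*}
    (y : ℤ → Ω → ι → ℝ) : Prop where
  memLp : ∀ t a, MemLp (fun ω => y t ω a) 2 P
  mean_const : ∀ s t a, ∫ ω, y s ω a ∂P = ∫ ω, y t ω a ∂P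
  autocovariance : ∀ s t h a b,
    covariance (fun ω => y (s + h) ω a) (fun ω => y s ω b) P
      = covariance (fun ω => y (t + h) ω a) (fun ω => y t ω b) P

/-- The vector process `y` is `I(0)`, with innovations `ε`: it is stationary and causal, that is
`y_t - E y_t = ∑_{i ≥ 0} C_i ε_{t-i}` almost surely with exponentially decreasing coefficients, and
the long-run matrix `C(1) = ∑ i, C_i` does not vanish. The last condition is required of every row
of `C(1)`, so that each component of `y` is `I(0)`. -/
def IsIntegratedOfOrderZero {Ω : Type*} [MeasurableSpace Ω] (P : Measure Ω)
    {κ ι : Type*} [Fintype κ] (ε : ℤ → Ω → κ → ℝ) (y : ℤ → Ω → ι → ℝ) : Prop :=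
  IsWeaklyStationary P y ∧
  ∃ C : ℕ → Matrix ι κ ℝ,
    (∃ K ρ : ℝ, 0 ≤ ρ ∧ ρ < 1 ∧ ∀ i a k, |C i a k| ≤ K * ρ ^ i) ∧
    (∀ t, ∀ᵐ ω ∂P, ∀ a,
      HasSum (fun i : ℕ => (C i *ᵥ ε (t - (i : ℤ)) ω) a) (y t ω a - ∫ ω', y t ω' a ∂P)) ∧
    (∀ a, ∃ k, ∑' i, C i a k ≠ 0)

/-- A matrix-valued process is `I(0)` if its vectorization is. -/
def IsMatrixIntegratedOfOrderZero {Ω : Type*} [MeasurableSpace Ω] (P : Measure Ω) {m n p q : ℕ}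
    (E : ℤ → Ω → Matrix (Fin m) (Fin n) ℝ) (Y : ℤ → Ω → Matrix (Fin p) (Fin q) ℝ) : Prop :=
  IsIntegratedOfOrderZero P (fun t ω => (E t ω).vec) (fun t ω => (Y t ω).vec)

/-- One step `X₀ ↦ X₁` of the error-correction recursion with innovation `e`:
`X₁ - X₀ = τγ'X₀ + X₀θφ' + τγ'X₀θφ' + e`. -/
def ECCMARStep {m n r₁ r₂ : ℕ}
    (τ γ : Matrix (Fin m) (Fin r₁) ℝ) (φ θ : Matrix (Fin n) (Fin r₂) ℝ)
    (X₀ X₁ e : Matrix (Fin m) (Fin n) ℝ) : Prop :=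
  X₁ - X₀ = τ * γᵀ * X₀ + X₀ * θ * φᵀ + τ * γᵀ * X₀ * θ * φᵀ + e

/-- The paths of `X` do not grow exponentially as time goes to `-∞`. -/
def HasSubexponentialPast {Ω : Type*} [MeasurableSpace Ω] (P : Measure Ω) {m n : ℕ}
    (X : ℤ → Ω → Matrix (Fin m) (Fin n) ℝ) : Prop :=
  ∀ᵐ ω ∂P, ∀ i j, ∀ r : ℝ, 1 < r →
    (fun k : ℕ => X (-(k : ℤ)) ω i j) =O[atTop] (fun k : ℕ => r ^ k)

/-- Almost surely, `V_t` and `W_t` approach each other at the exponential rate `ρ ^ t` on the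
dates `t = 0, 1, 2, …`. -/
def MergesExponentially {Ω : Type*} [MeasurableSpace Ω] (P : Measure Ω) {p q : ℕ} (ρ : ℝ)
    (V : ℕ → Ω → Matrix (Fin p) (Fin q) ℝ) (W : ℤ → Ω → Matrix (Fin p) (Fin q) ℝ) : Prop :=
  ∀ᵐ ω ∂P, ∃ K : ℝ, ∀ (t : ℕ) i j, |V t ω i j - W (t : ℤ) ω i j| ≤ K * ρ ^ t

/-! The row error satisfies a closed autoregression. With $N=I+\gamma'\tau$ one has
$\gamma'\Lambda=N\gamma'$, so $\operatorname{vec}(\gamma'X_t)$ is a vector autoregression with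
coefficient $\Psi\otimes N$ and innovation $(I\otimes\gamma')\operatorname{vec}E_t$. Passing from
$\Lambda$ to $N$ removes the unit roots, so the powers of $N$ decay geometrically
(`HasSemisimpleUnitRoots.hasGeometricPowers`), while those of $\Psi$ stay bounded
(`bounded_pow_of_hasGeometricPowers`). Hence the Kronecker product is stable. The column error is
symmetric, with $(I+\theta'\varphi)\otimes\Lambda$.

A stable autoregression $y_t=Ay_{t-1}+G\varepsilon_t$ is solved by $\sum_i A^iG\varepsilon_{t-i}$.
Two solutions differ by $A^k$ times their difference $k$ steps earlier. This gives uniqueness under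
a subexponential past (`exists_stationary_solution`) and exponential merging from any initial value
(`exists_stationary_matrix_solution`). Full rank of $\gamma$ and $\theta$ gives $G$ a right inverse,
so no row of the long-run matrix vanishes (`HasGeometricPowers.tsum_row_ne_zero`). -/

/-- The entries of the powers of `A` decrease exponentially. -/
def HasGeometricPowers {ι : Type*} [Fintype ι] [DecidableEq ι] (A : Matrix ι ι ℝ) : Prop :=
  ∃ K ρ : ℝ, 0 ≤ ρ ∧ ρ < 1 ∧ ∀ i a b, |(A ^ i) a b| ≤ K * ρ ^ i

/-! ### Geometric decay of matrix powers from the spectrum -/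

section Algebra

variable {ι κ : Type*} [Fintype ι] [DecidableEq ι] [Fintype κ] [DecidableEq κ]

attribute [local instance] Matrix.linftyOpNormedRing Matrix.linftyOpNormedAlgebra
  Matrix.linftyOpNormedAddCommGroup

theorem norm_entry_le_linfty_opNorm (A : Matrix ι ι ℂ) (a b : ι) : ‖A a b‖ ≤ ‖A‖ := by
  have h : ‖A a b‖₊ ≤ ‖A‖₊ := by
    rw [Matrix.linfty_opNNNorm_def]
    exact (Finset.single_le_sum (f := fun j => ‖A a j‖₊) (fun _ _ => zero_le)
      (Finset.mem_univ b)).trans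
      (Finset.le_sup (f := fun i => ∑ j, ‖A i j‖₊) (Finset.mem_univ a))
  exact_mod_cast h

theorem exists_norm_pow_le_of_spectrum_lt_one (A : Matrix ι ι ℂ)
    (hA : ∀ z ∈ spectrum ℂ A, ‖z‖ < 1) :
    ∃ K ρ : ℝ, 0 ≤ ρ ∧ ρ < 1 ∧ ∀ i a b, ‖(A ^ i) a b‖ ≤ K * ρ ^ i := by
  rcases isEmpty_or_nonempty ι with hι | hι
  · exact ⟨0, 0, le_rfl, zero_lt_one, fun _ a => hι.elim a⟩
  have h1 : spectralRadius ℂ A < (1 : NNReal) :=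
    spectrum.spectralRadius_lt_of_forall_lt A fun z hz => by exact_mod_cast hA z hz
  obtain ⟨ρ, hρ1, hρ2⟩ := ENNReal.lt_iff_exists_nnreal_btwn.1 h1
  have hρ0 : (ρ : ℝ) ≠ 0 := by
    rintro h
    have : ρ = 0 := by exact_mod_cast h
    simp [this] at hρ1
  have hO : (fun k => A ^ k) =O[atTop] (fun k : ℕ => (ρ : ℝ) ^ k) := by
    refine Asymptotics.IsBigO.of_bound 1 ?_
    -- Gelfand's formula: $\|A^k\|^{1/k}$ is eventually below $\rho$.
    filter_upwards [(spectrum.pow_nnnorm_pow_one_div_tendsto_nhds_spectralRadius A).eventually_lt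
      tendsto_const_nhds hρ1, eventually_gt_atTop 0] with k hk hk0
    have hk' : (k : ℝ) ≠ 0 := by exact_mod_cast hk0.ne'
    have h2 := ENNReal.rpow_le_rpow hk.le (Nat.cast_nonneg (α := ℝ) k)
    rw [← ENNReal.rpow_mul, one_div_mul_cancel hk', ENNReal.rpow_one, ENNReal.rpow_natCast] at h2
    have h3 : ‖A ^ k‖₊ ≤ ρ ^ k := by exact_mod_cast h2
    have h4 : ‖A ^ k‖ ≤ (ρ : ℝ) ^ k := by exact_mod_cast h3
    simpa using h4
  obtain ⟨K, -, hK⟩ := Asymptotics.bound_of_isBigO_nat_atTop hO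
  refine ⟨K, ρ, ρ.2, by exact_mod_cast hρ2, fun i a b => ?_⟩
  have := hK (x := i) (pow_ne_zero _ hρ0)
  rw [Real.norm_of_nonneg (pow_nonneg ρ.coe_nonneg i)] at this
  exact (norm_entry_le_linfty_opNorm _ a b).trans this

theorem hasGeometricPowers_of_spectrum_lt_one (A : Matrix ι ι ℝ)
    (hA : ∀ z ∈ spectrum ℂ (A.map Complex.ofReal), ‖z‖ < 1) : HasGeometricPowers A := by
  obtain ⟨K, ρ, h0, h1, h⟩ := exists_norm_pow_le_of_spectrum_lt_one _ hA
  refine ⟨K, ρ, h0, h1, fun i a b => ?_⟩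
  have hp : (A.map Complex.ofReal) ^ i = (A ^ i).map Complex.ofReal :=
    (map_pow (Complex.ofRealHom.mapMatrix) A i).symm
  simpa [hp] using h i a b

end Algebra

/-! ### Unit roots and the reduced matrix $I+\gamma'\tau$ -/

theorem exists_right_inverse_of_rank {m r : ℕ} (γ : Matrix (Fin m) (Fin r) ℝ) (hγ : γ.rank = r) :
    ∃ H : Matrix (Fin m) (Fin r) ℝ, γᵀ * H = 1 := by
  refine Matrix.mulVec_surjective_iff_exists_right_inverse.1 ?_
  have h : LinearMap.range γᵀ.mulVecLin = ⊤ :=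
    Submodule.eq_top_of_finrank_eq (by
      rw [← Matrix.rank, Matrix.rank_transpose, hγ, Module.finrank_fin_fun])
  exact LinearMap.range_eq_top.1 h

/-- The characteristic polynomial of $\tau\gamma'$ is $X^{m-r}$ times that of $\gamma'\tau$. Its
root $0$ has multiplicity exactly $m-r$, so nothing is left for the second factor. -/
theorem HasSemisimpleUnitRoots.det_ne_zero {m r : ℕ} {τ γ : Matrix (Fin m) (Fin r) ℝ}
    (h : HasSemisimpleUnitRoots (1 + τ * γᵀ) r) : (γᵀ * τ).det ≠ 0 := by
  have h1 := h.algebraic_multiplicity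
  have h2 : (τ * γᵀ).charpoly = (1 + τ * γᵀ).charpoly.comp (Polynomial.X + Polynomial.C 1) := by
    rw [← Matrix.charpoly_sub_scalar]
    simp
  rw [Polynomial.rootMultiplicity_eq_rootMultiplicity, ← h2,
    Matrix.charpoly_mul_comm_of_le _ _ (by simpa using h.lt.le)] at h1
  have h3 : (γᵀ * τ).charpoly ≠ 0 := (Matrix.charpoly_monic _).ne_zero
  have h4 : (γᵀ * τ).charpoly.rootMultiplicity 0 = 0 := by
    rw [Polynomial.rootMultiplicity_mul (mul_ne_zero (pow_ne_zero _ Polynomial.X_ne_zero) h3)] at h1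
    have := Polynomial.rootMultiplicity_X_sub_C_pow (0 : ℝ) (m - r)
    simp only [Polynomial.C_0, sub_zero] at this
    simp only [Fintype.card_fin, this] at h1
    omega
  intro h0
  have h5 : (γᵀ * τ).charpoly.IsRoot 0 := by
    rw [Polynomial.IsRoot.def, Matrix.eval_charpoly]
    simp [Matrix.det_neg, h0]
  exact (Polynomial.rootMultiplicity_pos h3).2 h5 |>.ne' h4

/-- If $w$ is an eigenvector of $I+\gamma'\tau$ for $z$, then $\tau w$ is one of $I+\tau\gamma'$ for
the same $z$. Since $\gamma'\tau$ is nonsingular, $\tau w\ne0$ and $z\ne1$, so $|z|<1$ by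
assumption. -/
theorem HasSemisimpleUnitRoots.hasGeometricPowers {m r : ℕ} {τ γ : Matrix (Fin m) (Fin r) ℝ}
    (h : HasSemisimpleUnitRoots (1 + τ * γᵀ) r) : HasGeometricPowers (1 + γᵀ * τ) := by
  refine hasGeometricPowers_of_spectrum_lt_one _ fun z hz => ?_
  set τ' := τ.map Complex.ofReal with hτ'
  set γ' := γᵀ.map Complex.ofReal with hγ'
  have e1 : (1 + γᵀ * τ).map Complex.ofReal = 1 + γ' * τ' := by
    ext i j
    by_cases hij : i = j <;> simp [hij, hτ', hγ', Matrix.mul_apply]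
  have e2 : (1 + τ * γᵀ).map Complex.ofReal = 1 + τ' * γ' := by
    ext i j
    by_cases hij : i = j <;> simp [hij, hτ', hγ', Matrix.mul_apply]
  rw [e1, ← Matrix.spectrum_toLin', ← Module.End.hasEigenvalue_iff_mem_spectrum] at hz
  obtain ⟨w, hw⟩ := hz.exists_hasEigenvector
  have hw1 := hw.apply_eq_smul
  rw [Matrix.toLin'_apply, Matrix.add_mulVec, Matrix.one_mulVec] at hw1
  have hdet : (γ' * τ').det ≠ 0 := by
    have : γ' * τ' = (γᵀ * τ).map Complex.ofReal := by
      ext i j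
      simp [hτ', hγ', Matrix.mul_apply]
    have h2 : ((γᵀ * τ).map Complex.ofReal).det = Complex.ofReal (γᵀ * τ).det :=
      (RingHom.map_det Complex.ofRealHom (γᵀ * τ)).symm
    rw [this, h2]
    exact_mod_cast h.det_ne_zero
  have hne : (γ' * τ') *ᵥ w ≠ 0 := fun h0 =>
    hdet (Matrix.exists_mulVec_eq_zero_iff.1 ⟨w, hw.2, h0⟩)
  refine h.stable z ?_ ?_
  · rw [e2]
    refine Module.End.hasEigenvalue_of_hasEigenvector (x := τ' *ᵥ w)
      ⟨Module.End.mem_eigenspace_iff.2 ?_, fun h0 => ?_⟩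
    · rw [Matrix.toLin'_apply, Matrix.add_mulVec, Matrix.one_mulVec, ← Matrix.mulVec_smul, ← hw1,
        Matrix.mulVec_add, Matrix.mulVec_mulVec, Matrix.mulVec_mulVec, Matrix.mul_assoc]
    · rw [← Matrix.mulVec_mulVec, h0, Matrix.mulVec_zero] at hne
      exact hne rfl
  · rintro rfl
    exact hne (by simpa using hw1)

/-- From $\Lambda\tau=\tau N$ follows $\Lambda^i=I+\sum_{j<i}\tau N^j\gamma'$, whose sum is
dominated by a convergent geometric series. -/
theorem bounded_pow_of_hasGeometricPowers {m r : ℕ} {Λ : Matrix (Fin m) (Fin m) ℝ}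
    {τ γ : Matrix (Fin m) (Fin r) ℝ} (hΛ : Λ = 1 + τ * γᵀ)
    (h : HasGeometricPowers (1 + γᵀ * τ)) :
    ∃ B : ℝ, ∀ i a b, |(Λ ^ i) a b| ≤ B := by
  obtain ⟨K, ρ, h0, h1, hK⟩ := h
  set N := 1 + γᵀ * τ with hN
  have hcomm : ∀ i, Λ ^ i * τ = τ * N ^ i := by
    intro i
    induction i with
    | zero => simp
    | succ i ih =>
      rw [pow_succ, Matrix.mul_assoc, pow_succ', ← Matrix.mul_assoc τ,
        show Λ * τ = τ * N by
          rw [hN, hΛ, Matrix.add_mul, Matrix.mul_add, Matrix.mul_assoc, Matrix.one_mul,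
            Matrix.mul_one], ← Matrix.mul_assoc, ih, Matrix.mul_assoc, Matrix.mul_assoc,
        (Commute.refl N).pow_left i |>.eq]
  have hstep : ∀ i a b, (Λ ^ i) a b
      = (1 : Matrix (Fin m) (Fin m) ℝ) a b
        + ∑ j ∈ Finset.range i, ∑ k, ∑ l, τ a k * (N ^ j) k l * γ b l := by
    intro i a b
    induction i with
    | zero => simp
    | succ i ih =>
      rw [pow_succ]
      nth_rewrite 2 [hΛ]
      rw [Matrix.mul_add, Matrix.mul_one, ← Matrix.mul_assoc, hcomm, Matrix.add_apply,
        ih, Finset.sum_range_succ, add_assoc, Matrix.mul_apply]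
      congr 2
      simp only [Matrix.mul_apply, Finset.sum_mul, Matrix.transpose_apply]
      rw [Finset.sum_comm]
  have hsum : Summable fun j : ℕ => |K| * ρ ^ j :=
    (summable_geometric_of_lt_one h0 h1).mul_left _
  have hbd : ∀ i a b, |(Λ ^ i) a b|
      ≤ |(1 : Matrix (Fin m) (Fin m) ℝ) a b|
        + ∑' j : ℕ, ∑ k, ∑ l, |τ a k| * (|K| * ρ ^ j) * |γ b l| := by
    intro i a b
    rw [hstep]
    refine (abs_add_le _ _).trans (add_le_add le_rfl ?_)
    refine (Finset.abs_sum_le_sum_abs _ _).trans ?_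
    refine le_trans (Finset.sum_le_sum fun j _ => ?_) (Summable.sum_le_tsum _ (fun j _ => ?_) ?_)
    · refine (Finset.abs_sum_le_sum_abs _ _).trans (Finset.sum_le_sum fun k _ => ?_)
      refine (Finset.abs_sum_le_sum_abs _ _).trans (Finset.sum_le_sum fun l _ => ?_)
      rw [abs_mul, abs_mul]
      have : |(N ^ j) k l| ≤ |K| * ρ ^ j :=
        (hK j k l).trans (mul_le_mul_of_nonneg_right (le_abs_self K) (pow_nonneg h0 j))
      gcongr
    · positivity
    · exact summable_sum fun k _ => summable_sum fun l _ => (hsum.mul_left _).mul_right _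
  refine ⟨∑ a, ∑ b, (|(1 : Matrix (Fin m) (Fin m) ℝ) a b|
    + ∑' j : ℕ, ∑ k, ∑ l, |τ a k| * (|K| * ρ ^ j) * |γ b l|), fun i a b => ?_⟩
  have hnn : ∀ a b, 0 ≤ |(1 : Matrix (Fin m) (Fin m) ℝ) a b|
      + ∑' j : ℕ, ∑ k, ∑ l, |τ a k| * (|K| * ρ ^ j) * |γ b l| := fun a b =>
    (abs_nonneg _).trans (hbd 0 a b)
  refine (hbd i a b).trans ((Finset.single_le_sum (f := fun b => _) (fun b _ => hnn a b)
    (Finset.mem_univ b)).trans (Finset.single_le_sum (f := fun a => ∑ b, _)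
      (fun a _ => Finset.sum_nonneg fun b _ => hnn a b) (Finset.mem_univ a)))

/-! ### Kronecker products of a stable and a power-bounded matrix -/

section Kronecker

open scoped Kronecker

variable {ι κ : Type*} [Fintype ι] [DecidableEq ι] [Fintype κ] [DecidableEq κ]

theorem kronecker_pow_apply (A : Matrix ι ι ℝ) (B : Matrix κ κ ℝ) (i : ℕ) (a b : ι × κ) :
    ((A ⊗ₖ B) ^ i) a b = (A ^ i) a.1 b.1 * (B ^ i) a.2 b.2 := by
  have : (A ⊗ₖ B) ^ i = (A ^ i) ⊗ₖ (B ^ i) := by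
    induction i with
    | zero => simp
    | succ i ih => rw [pow_succ, ih, ← Matrix.mul_kronecker_mul, pow_succ, pow_succ]
  rw [this, Matrix.kroneckerMap_apply]

theorem HasGeometricPowers.kronecker_left {A : Matrix ι ι ℝ} {B : Matrix κ κ ℝ}
    (hA : HasGeometricPowers A) (hB : ∃ b : ℝ, ∀ i j k, |(B ^ i) j k| ≤ b) :
    HasGeometricPowers (A ⊗ₖ B) := by
  obtain ⟨K, ρ, h0, h1, hK⟩ := hA
  obtain ⟨b, hb⟩ := hB
  refine ⟨K * b, ρ, h0, h1, fun i x y => ?_⟩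
  rw [kronecker_pow_apply, abs_mul]
  calc _ ≤ K * ρ ^ i * b := mul_le_mul (hK _ _ _) (hb _ _ _) (abs_nonneg _)
        ((abs_nonneg _).trans (hK i x.1 y.1))
    _ = _ := by ring

theorem HasGeometricPowers.kronecker_right {A : Matrix ι ι ℝ} {B : Matrix κ κ ℝ}
    (hA : ∃ b : ℝ, ∀ i j k, |(A ^ i) j k| ≤ b) (hB : HasGeometricPowers B) :
    HasGeometricPowers (A ⊗ₖ B) := by
  obtain ⟨K, ρ, h0, h1, hK⟩ := hB
  obtain ⟨b, hb⟩ := hA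
  refine ⟨b * K, ρ, h0, h1, fun i x y => ?_⟩
  rw [kronecker_pow_apply, abs_mul, mul_assoc]
  exact mul_le_mul (hb _ _ _) (hK _ _ _) (abs_nonneg _) ((abs_nonneg _).trans (hb i x.1 y.1))

end Kronecker

/-! ### Linear processes driven by white noise -/

section Probability

variable {Ω : Type*} [MeasurableSpace Ω] {P : Measure Ω} {κ ι : Type*}

theorem covariance_congr_ae {X X' Y Y' : Ω → ℝ} (hX : X =ᵐ[P] X') (hY : Y =ᵐ[P] Y') :
    covariance X Y P = covariance X' Y' P := by
  unfold covariance
  rw [integral_congr_ae hX, integral_congr_ae hY]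
  refine integral_congr_ae ?_
  filter_upwards [hX, hY] with ω h1 h2
  rw [h1, h2]

theorem IsIntegratedOfOrderZero.congr [Fintype κ] {ε : ℤ → Ω → κ → ℝ} {y v : ℤ → Ω → ι → ℝ}
    (hy : IsIntegratedOfOrderZero P ε y) (h : ∀ t, ∀ᵐ ω ∂P, v t ω = y t ω) :
    IsIntegratedOfOrderZero P ε v := by
  have h' : ∀ t a, (fun ω => v t ω a) =ᵐ[P] fun ω => y t ω a := fun t a => by
    filter_upwards [h t] with ω hω
    rw [hω]
  obtain ⟨⟨h1, h2, h3⟩, C, hC, hs, hr⟩ := hy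
  refine ⟨⟨fun t a => (memLp_congr_ae (h' t a)).2 (h1 t a), fun s t a => ?_,
    fun s t u a b => ?_⟩, C, hC, fun t => ?_, hr⟩
  · rw [integral_congr_ae (h' s a), integral_congr_ae (h' t a), h2 s t]
  · rw [covariance_congr_ae (h' _ a) (h' _ b), covariance_congr_ae (h' _ a) (h' _ b), h3 s t]
  · filter_upwards [h t, hs t] with ω h4 h5 a
    rw [integral_congr_ae (h' t a), h4]
    exact h5 a

variable [IsProbabilityMeasure P]

theorem covariance_eq_inner {f g : Lp ℝ 2 P} (hf : ∫ ω, f ω ∂P = 0) :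
    covariance f g P = inner ℝ f g := by
  rw [covariance_eq_sub (Lp.memLp f) (Lp.memLp g), hf, zero_mul, sub_zero, L2.inner_def]
  refine integral_congr_ae (Eventually.of_forall fun ω => ?_)
  simp [mul_comm]

namespace IsWhiteNoise

variable {ε : ℤ → Ω → κ → ℝ}

/-- The components of a white noise as elements of `L²`. -/
noncomputable def toLp (hε : IsWhiteNoise P ε) (t : ℤ) (k : κ) : Lp ℝ 2 P :=
  (hε.memLp t k).toLp _

theorem coeFn_toLp (hε : IsWhiteNoise P ε) (t : ℤ) (k : κ) :
    hε.toLp t k =ᵐ[P] fun ω => ε t ω k :=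
  (hε.memLp t k).coeFn_toLp

theorem integral_toLp (hε : IsWhiteNoise P ε) (t : ℤ) (k : κ) :
    ∫ ω, hε.toLp t k ω ∂P = 0 := by
  rw [integral_congr_ae (hε.coeFn_toLp t k), hε.mean_zero]

theorem inner_toLp (hε : IsWhiteNoise P ε) (s t : ℤ) (k l : κ) :
    inner ℝ (hε.toLp s k) (hε.toLp t l)
      = covariance (fun ω => ε s ω k) (fun ω => ε t ω l) P := by
  rw [← covariance_eq_inner (hε.integral_toLp s k)]
  exact covariance_congr_ae (hε.coeFn_toLp s k) (hε.coeFn_toLp t l)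

theorem inner_toLp_shift (hε : IsWhiteNoise P ε) {s t s' t' : ℤ} (h : s - t = s' - t') (k l : κ) :
    inner ℝ (hε.toLp s k) (hε.toLp t l) = inner ℝ (hε.toLp s' k) (hε.toLp t' l) := by
  rw [hε.inner_toLp, hε.inner_toLp]
  rcases eq_or_ne s t with rfl | hst
  · obtain rfl : s' = t' := by omega
    exact hε.covariance_const s s' k l
  · rw [hε.uncorrelated s t k l hst, hε.uncorrelated s' t' k l (by omega)]

theorem norm_toLp (hε : IsWhiteNoise P ε) (t : ℤ) (k : κ) : ‖hε.toLp t k‖ = ‖hε.toLp 0 k‖ := by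
  rw [norm_eq_sqrt_real_inner, norm_eq_sqrt_real_inner,
    hε.inner_toLp_shift (s := t) (t := t) (s' := 0) (t' := 0) (by simp)]

/-- The `i`-th term of a linear process in `L²`. -/
noncomputable def linearTerm [Fintype κ] (hε : IsWhiteNoise P ε) (C : ℕ → Matrix ι κ ℝ) (t : ℤ) (a : ι)
    (i : ℕ) : Lp ℝ 2 P :=
  ∑ k, C i a k • hε.toLp (t - i) k

variable [Fintype κ]

theorem coeFn_term (hε : IsWhiteNoise P ε) (C : ℕ → Matrix ι κ ℝ) (t : ℤ) (a : ι) (i : ℕ) :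
    hε.linearTerm C t a i =ᵐ[P] fun ω => (C i *ᵥ ε (t - (i : ℤ)) ω) a := by
  have h1 : ∀ᵐ ω ∂P, ∀ k, (C i a k • hε.toLp (t - i) k : Lp ℝ 2 P) ω = C i a k * ε (t - i) ω k := by
    refine ae_all_iff.2 fun k => ?_
    filter_upwards [Lp.coeFn_smul (C i a k) (hε.toLp (t - i) k), hε.coeFn_toLp (t - i) k]
      with ω h2 h3
    rw [h2, Pi.smul_apply, h3, smul_eq_mul]
  filter_upwards [Lp.coeFn_fun_finsetSum Finset.univ fun k => C i a k • hε.toLp (t - i) k, h1]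
    with ω h2 h3
  rw [linearTerm, h2, Matrix.mulVec, dotProduct]
  exact Finset.sum_congr rfl fun k _ => h3 k

theorem summable_norm_term (hε : IsWhiteNoise P ε) {C : ℕ → Matrix ι κ ℝ}
    (hC : ∃ K ρ : ℝ, 0 ≤ ρ ∧ ρ < 1 ∧ ∀ i a k, |C i a k| ≤ K * ρ ^ i) (t : ℤ) (a : ι) :
    Summable (fun i => ‖hε.linearTerm C t a i‖) := by
  obtain ⟨K, ρ, h0, h1, hK⟩ := hC
  refine Summable.of_nonneg_of_le (fun _ => norm_nonneg _) (fun i => ?_)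
    ((summable_geometric_of_lt_one h0 h1).mul_left (K * ∑ k, ‖hε.toLp 0 k‖))
  refine (norm_sum_le _ _).trans ?_
  calc _ ≤ ∑ k, K * ρ ^ i * ‖hε.toLp 0 k‖ := by
        refine Finset.sum_le_sum fun k _ => ?_
        rw [norm_smul, hε.norm_toLp, Real.norm_eq_abs]
        exact mul_le_mul_of_nonneg_right (hK i a k) (norm_nonneg _)
    _ = _ := by rw [← Finset.mul_sum]; ring

theorem inner_term_shift (hε : IsWhiteNoise P ε) (C : ℕ → Matrix ι κ ℝ) (s t h : ℤ) (a b : ι)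
    (i j : ℕ) : inner ℝ (hε.linearTerm C (s + h) a i) (hε.linearTerm C s b j)
      = inner ℝ (hε.linearTerm C (t + h) a i) (hε.linearTerm C t b j) := by
  simp only [linearTerm, sum_inner, inner_sum, real_inner_smul_left, real_inner_smul_right]
  refine Finset.sum_congr rfl fun k _ => Finset.sum_congr rfl fun l _ => ?_
  rw [hε.inner_toLp_shift (s' := t + h - i) (t' := t - j) (by ring)]

theorem integral_eq_inner_one (f : Lp ℝ 2 P) :
    ∫ ω, f ω ∂P = inner ℝ ((memLp_const (1 : ℝ)).toLp (fun _ : Ω => (1 : ℝ)) : Lp ℝ 2 P) f := by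
  rw [L2.inner_def]
  refine integral_congr_ae ?_
  filter_upwards [(memLp_const (1 : ℝ)).coeFn_toLp (p := 2) (μ := P)] with ω hω
  rw [hω]
  simp

theorem integral_term (hε : IsWhiteNoise P ε) (C : ℕ → Matrix ι κ ℝ) (t : ℤ) (a : ι) (i : ℕ) :
    ∫ ω, hε.linearTerm C t a i ω ∂P = 0 := by
  rw [integral_eq_inner_one, linearTerm, inner_sum]
  refine Finset.sum_eq_zero fun k _ => ?_
  rw [real_inner_smul_right, ← integral_eq_inner_one, hε.integral_toLp, mul_zero]

/-- The series converges absolutely in $L^2$. Means and covariances are inner products there, so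
they pass through the sum, and stationarity reduces to shift invariance of the terms. -/
theorem exists_linear_process (hε : IsWhiteNoise P ε) (C : ℕ → Matrix ι κ ℝ) [Finite ι]
    (hC : ∃ K ρ : ℝ, 0 ≤ ρ ∧ ρ < 1 ∧ ∀ i a k, |C i a k| ≤ K * ρ ^ i) :
    ∃ y : ℤ → Ω → ι → ℝ, IsWeaklyStationary P y ∧ (∀ t a, ∫ ω, y t ω a ∂P = 0) ∧
      ∀ t, ∀ᵐ ω ∂P, ∀ a,
        HasSum (fun i : ℕ => (C i *ᵥ ε (t - (i : ℤ)) ω) a) (y t ω a) := by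
  have hs := fun t a => (hε.summable_norm_term hC t a)
  have hs' := fun t a => (hs t a).of_norm
  have hint : ∀ t a, ∫ ω, (∑' i, hε.linearTerm C t a i : Lp ℝ 2 P) ω ∂P = 0 := fun t a => by
    rw [integral_eq_inner_one, ← innerSL_apply_apply ℝ, ContinuousLinearMap.map_tsum _ (hs' t a)]
    simp_rw [innerSL_apply_apply, ← integral_eq_inner_one, hε.integral_term, tsum_zero]
  refine ⟨fun t ω a => (∑' i, hε.linearTerm C t a i : Lp ℝ 2 P) ω,
    ⟨fun t a => Lp.memLp _, fun s t a => ?_, fun s t h a b => ?_⟩, hint, fun t => ?_⟩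
  · rw [hint, hint]
  · rw [covariance_eq_inner (hint _ _), covariance_eq_inner (hint _ _)]
    have key : ∀ s t : ℤ, ∀ a b, inner ℝ (∑' i, hε.linearTerm C s a i) (∑' i, hε.linearTerm C t b i)
        = ∑' j, ∑' i, inner ℝ (hε.linearTerm C s a i) (hε.linearTerm C t b j) := fun s t a b => by
      rw [← innerSL_apply_apply ℝ, ContinuousLinearMap.map_tsum _ (hs' t b)]
      refine tsum_congr fun j => ?_
      rw [innerSL_apply_apply, real_inner_comm, ← innerSL_apply_apply ℝ,
        ContinuousLinearMap.map_tsum _ (hs' s a)]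
      refine tsum_congr fun i => ?_
      rw [innerSL_apply_apply, real_inner_comm]
    rw [key, key]
    exact tsum_congr fun j => tsum_congr fun i => hε.inner_term_shift C s t h a b i j
  · refine ae_all_iff.2 fun a => ?_
    -- Summability of the $L^2$ norms upgrades convergence in $L^2$ to almost sure convergence.
    have h1 : ∑' i, ‖hε.linearTerm C t a i‖ₑ ≠ ⊤ := by
      have := (hs t a).tsum_ofReal_ne_top
      simpa only [ofReal_norm] using this
    filter_upwards [Lp.hasSum_coeFn_tsum h1, ae_all_iff.2 fun i => hε.coeFn_term C t a i]
      with ω h2 h3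
    simpa only [h3] using h2

end IsWhiteNoise

end Probability

/-! ### Stable vector autoregressions -/

section VectorAutoregression

variable {ι κ : Type*} [Fintype ι] [DecidableEq ι] [Fintype κ]

theorem HasGeometricPowers.mul_right {A : Matrix ι ι ℝ} (hA : HasGeometricPowers A)
    (G : Matrix ι κ ℝ) :
    ∃ K ρ : ℝ, 0 ≤ ρ ∧ ρ < 1 ∧ ∀ i a k, |(A ^ i * G) a k| ≤ K * ρ ^ i := by
  obtain ⟨K, ρ, h0, h1, hK⟩ := hA
  refine ⟨K * ∑ k, ∑ b, |G b k|, ρ, h0, h1, fun i a k => ?_⟩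
  have hKρ : 0 ≤ K * ρ ^ i := (abs_nonneg _).trans (hK i a a)
  calc |(A ^ i * G) a k| ≤ ∑ b, |(A ^ i) a b * G b k| := by
        rw [Matrix.mul_apply]
        exact Finset.abs_sum_le_sum_abs _ _
    _ ≤ ∑ b, K * ρ ^ i * |G b k| := Finset.sum_le_sum fun b _ => by
        rw [abs_mul]
        exact mul_le_mul_of_nonneg_right (hK i a b) (abs_nonneg _)
    _ = K * ρ ^ i * ∑ b, |G b k| := by rw [Finset.mul_sum]
    _ ≤ K * ρ ^ i * ∑ k, ∑ b, |G b k| := mul_le_mul_of_nonneg_left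
        (Finset.single_le_sum (f := fun k => ∑ b, |G b k|)
          (fun _ _ => Finset.sum_nonneg fun _ _ => abs_nonneg _) (Finset.mem_univ k)) hKρ
    _ = _ := by ring

/-- A zero row of $SG$, where $S=\sum_iA^i$, is a zero row of $S$ because $G$ has a right inverse.
This contradicts $S=I+SA$ on the diagonal. -/
theorem HasGeometricPowers.tsum_row_ne_zero {A : Matrix ι ι ℝ} (hA : HasGeometricPowers A)
    {G : Matrix ι κ ℝ} {H : Matrix κ ι ℝ} (hGH : G * H = 1) (a : ι) :
    ∃ k, ∑' i : ℕ, (A ^ i * G) a k ≠ 0 := by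
  by_contra! hzero
  obtain ⟨K, ρ, h0, h1, hK⟩ := hA
  have hsA : ∀ b, Summable fun i => (A ^ i) a b := fun b =>
    Summable.of_norm_bounded ((summable_geometric_of_lt_one h0 h1).mul_left K)
      fun i => hK i a b
  have hG : ∀ k, ∑ b, (∑' i, (A ^ i) a b) * G b k = 0 := fun k => by
    rw [← hzero k]
    simp_rw [Matrix.mul_apply]
    rw [Summable.tsum_finsetSum fun b _ => (hsA b).mul_right _]
    exact Finset.sum_congr rfl fun b _ => tsum_mul_right.symm
  have hS : (fun b => ∑' i, (A ^ i) a b) = 0 := by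
    have h2 : (fun b => ∑' i, (A ^ i) a b) ᵥ* G = 0 := by
      ext k
      simpa [Matrix.vecMul, dotProduct] using hG k
    rw [← Matrix.vecMul_one (fun b => ∑' i, (A ^ i) a b), ← hGH, ← Matrix.vecMul_vecMul, h2,
      Matrix.zero_vecMul]
  have h3 : ∀ b, ∑' i, (A ^ i) a b = 0 := fun b => congrFun hS b
  have h4 : ∑' i, (A ^ i) a a = (1 : Matrix ι ι ℝ) a a + ∑' i, (A ^ (i + 1)) a a := by
    rw [(hsA a).tsum_eq_zero_add, pow_zero]
  have h5 : ∑' i, (A ^ (i + 1)) a a = 0 := by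
    simp_rw [pow_succ, Matrix.mul_apply]
    rw [Summable.tsum_finsetSum fun b _ => (hsA b).mul_right _]
    refine Finset.sum_eq_zero fun b _ => ?_
    rw [tsum_mul_right, h3, zero_mul]
  rw [h3, h5, Matrix.one_apply_eq] at h4
  norm_num at h4

theorem tendsto_pow_mulVec_zero {A : Matrix ι ι ℝ} (hA : HasGeometricPowers A) {v : ℕ → ι → ℝ}
    (hv : ∀ a, ∀ r : ℝ, 1 < r → (fun k => v k a) =O[atTop] fun k : ℕ => r ^ k) (a : ι) :
    Tendsto (fun k => (A ^ k *ᵥ v k) a) atTop (nhds 0) := by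
  obtain ⟨K, ρ, h0, h1, hK⟩ := hA
  -- A growth rate above $1$ whose product with $\rho$ is still below $1$.
  have hr : 1 < 2 / (1 + ρ) := by rw [lt_div_iff₀ (by linarith)]; linarith
  have hρr : ρ * (2 / (1 + ρ)) < 1 := by
    rw [← mul_div_assoc, div_lt_one (by linarith)]; linarith
  simp only [Matrix.mulVec, dotProduct]
  rw [← Finset.sum_const_zero (s := (Finset.univ : Finset ι))]
  refine tendsto_finsetSum _ fun b _ => ?_
  have hO : (fun k => (A ^ k) a b) =O[atTop] fun k : ℕ => ρ ^ k :=
    Asymptotics.IsBigO.of_bound K (Eventually.of_forall fun k => by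
      rw [Real.norm_eq_abs, Real.norm_of_nonneg (pow_nonneg h0 k)]
      exact hK k a b)
  refine (hO.mul (hv b _ hr)).trans_tendsto ?_
  simp_rw [← mul_pow]
  exact tendsto_pow_atTop_nhds_zero_of_lt_one (by positivity) hρr

variable {Ω : Type*} [MeasurableSpace Ω] {P : Measure Ω} {ε : ℤ → Ω → κ → ℝ}

theorem autoregression_iterate {A : Matrix ι ι ℝ} {w : ℤ → ι → ℝ} {u : ℤ → ι → ℝ}
    (h : ∀ t, w t = A *ᵥ w (t - 1) + u t) (t : ℤ) (k : ℕ) :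
    w t = ∑ i ∈ Finset.range k, A ^ i *ᵥ u (t - i) + A ^ k *ᵥ w (t - k) := by
  induction k with
  | zero => simp
  | succ k ih =>
    nth_rewrite 1 [ih, h (t - k)]
    rw [Finset.sum_range_succ, Matrix.mulVec_add, Matrix.mulVec_mulVec, ← pow_succ,
      show t - (k : ℤ) - 1 = t - ((k + 1 : ℕ) : ℤ) by push_cast; ring]
    abel

/-- The stationary solution of a stable vector autoregression, and its uniqueness among the
solutions without exponential growth in the past. -/
theorem exists_stationary_solution [IsProbabilityMeasure P] (hε : IsWhiteNoise P ε)
    {A : Matrix ι ι ℝ} (hA : HasGeometricPowers A) {G : Matrix ι κ ℝ} {H : Matrix κ ι ℝ}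
    (hGH : G * H = 1) :
    ∃ y : ℤ → Ω → ι → ℝ, IsIntegratedOfOrderZero P ε y ∧
      (∀ t, ∀ᵐ ω ∂P, y t ω = A *ᵥ y (t - 1) ω + G *ᵥ ε t ω) ∧
      ∀ v : ℤ → Ω → ι → ℝ, (∀ t, ∀ᵐ ω ∂P, v t ω = A *ᵥ v (t - 1) ω + G *ᵥ ε t ω) →
        (∀ᵐ ω ∂P, ∀ a, ∀ r : ℝ, 1 < r →
          (fun k : ℕ => v (-(k : ℤ)) ω a) =O[atTop] fun k : ℕ => r ^ k) →
        ∀ t, ∀ᵐ ω ∂P, v t ω = y t ω := by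
  obtain ⟨y, hy, hmean, hsum⟩ := hε.exists_linear_process (fun i => A ^ i * G) (hA.mul_right G)
  refine ⟨y, ⟨hy, fun i => A ^ i * G, hA.mul_right G, fun t => ?_, hA.tsum_row_ne_zero hGH⟩,
    fun t => ?_, fun v hv hpast t => ?_⟩
  · filter_upwards [hsum t] with ω hω a
    rw [hmean, sub_zero]
    exact hω a
  · filter_upwards [hsum t, hsum (t - 1)] with ω h1 h2
    replace h1 : HasSum (fun i : ℕ => (A ^ i * G) *ᵥ ε (t - (i : ℤ)) ω) (y t ω) := Pi.hasSum.2 h1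
    replace h2 : HasSum (fun i : ℕ => (A ^ i * G) *ᵥ ε (t - 1 - (i : ℤ)) ω) (y (t - 1) ω) :=
      Pi.hasSum.2 h2
    have h3 := h2.map A.mulVecLin (LinearMap.continuous_of_finiteDimensional _)
    have h4 : (A.mulVecLin ∘ fun i : ℕ => (A ^ i * G) *ᵥ ε (t - 1 - (i : ℤ)) ω)
        = fun i : ℕ => (A ^ (i + 1) * G) *ᵥ ε (t - ((i + 1 : ℕ) : ℤ)) ω := by
      ext1 i
      rw [Function.comp_apply, Matrix.mulVecLin_apply, Matrix.mulVec_mulVec, ← Matrix.mul_assoc,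
        ← pow_succ', show t - 1 - (i : ℤ) = t - ((i + 1 : ℕ) : ℤ) by push_cast; ring]
    rw [h4] at h3
    -- Applying $A$ to the series at $t-1$ yields the series at $t$ without its term $i=0$, which is
    -- $G\varepsilon_t$.
    have h5 := h1.unique ((hasSum_nat_add_iff' 1).1 (by simpa using h3) :
      HasSum _ (A *ᵥ y (t - 1) ω + G *ᵥ ε t ω))
    exact h5
  · filter_upwards [hsum t, hpast, ae_all_iff.2 hv] with ω h1 h2 h3
    ext a
    have h4 := autoregression_iterate (w := fun t => v t ω) (u := fun t => G *ᵥ ε t ω) h3 t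
    have h5 : Tendsto (fun k : ℕ => (A ^ k *ᵥ v (t - k) ω) a) atTop (nhds 0) := by
      refine tendsto_pow_mulVec_zero hA (v := fun k => v (t - k) ω) (fun b r hr => ?_) a
      obtain ⟨N, hN⟩ : ∃ N : ℕ, t ≤ N := ⟨t.toNat, Int.self_le_toNat t⟩
      have hO : (fun k : ℕ => v (t - k) ω b) =O[atTop] fun k : ℕ => r ^ ((k : ℤ) - t).toNat := by
        have h6 : Tendsto (fun k : ℕ => ((k : ℤ) - t).toNat) atTop atTop := by
          refine tendsto_atTop.2 fun M => ?_
          filter_upwards [eventually_ge_atTop (M + N)] with k hk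
          omega
        refine ((h2 b r hr).comp_tendsto h6).congr' ?_ EventuallyEq.rfl
        filter_upwards [eventually_ge_atTop N] with k hk
        rw [Function.comp_apply, show -((((k : ℤ) - t).toNat : ℕ) : ℤ) = t - k by omega]
      -- The past bound is anchored at date $0$; moving the anchor to $t$ costs only this constant
      -- factor.
      refine hO.trans (Asymptotics.IsBigO.of_bound (r ^ (-t).toNat)
        (Eventually.of_forall fun k => ?_))
      have hr0 : 0 ≤ r := by linarith
      rw [Real.norm_of_nonneg (pow_nonneg hr0 _), Real.norm_of_nonneg (pow_nonneg hr0 _),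
        ← pow_add]
      exact pow_le_pow_right₀ hr.le (by omega)
    have h6 : Tendsto (fun k : ℕ => ∑ i ∈ Finset.range k, ((A ^ i * G) *ᵥ ε (t - (i : ℤ)) ω) a
        + (A ^ k *ᵥ v (t - k) ω) a) atTop (nhds (y t ω a + 0)) :=
      (h1 a).tendsto_sum_nat.add h5
    rw [add_zero] at h6
    refine tendsto_nhds_unique (tendsto_const_nhds.congr fun k => ?_) h6
    have := congrFun (h4 k) a
    simpa [Finset.sum_apply, Matrix.mulVec_mulVec] using this

theorem autoregression_sub_iterate {A : Matrix ι ι ℝ} {w y : ℕ → ι → ℝ} {u : ℕ → ι → ℝ}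
    (hw : ∀ t, w (t + 1) = A *ᵥ w t + u t) (hy : ∀ t, y (t + 1) = A *ᵥ y t + u t) (t : ℕ) :
    w t - y t = A ^ t *ᵥ (w 0 - y 0) := by
  induction t with
  | zero => simp
  | succ t ih =>
    rw [hw, hy, add_sub_add_right_eq_sub, ← Matrix.mulVec_sub, ih, Matrix.mulVec_mulVec, pow_succ']

end VectorAutoregression

/-! ### Matrix form and the equilibrium errors -/

section MatrixAutoregression

open scoped Kronecker

variable {Ω : Type*} [MeasurableSpace Ω] {P : Measure Ω}

theorem MergesExponentially.mono {p q : ℕ} {ρ ρ' : ℝ} (h0 : 0 ≤ ρ) (h : ρ ≤ ρ')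
    {V : ℕ → Ω → Matrix (Fin p) (Fin q) ℝ} {W : ℤ → Ω → Matrix (Fin p) (Fin q) ℝ}
    (hV : MergesExponentially P ρ V W) : MergesExponentially P ρ' V W := by
  filter_upwards [hV] with ω hω
  obtain ⟨K, hK⟩ := hω
  refine ⟨|K|, fun t i j => (hK t i j).trans ?_⟩
  exact mul_le_mul (le_abs_self K) (pow_le_pow_left₀ h0 h t) (pow_nonneg h0 t) (abs_nonneg K)

theorem exists_stationary_matrix_solution [IsProbabilityMeasure P] {m n p q : ℕ}
    {E : ℤ → Ω → Matrix (Fin m) (Fin n) ℝ} (hE : IsWhiteNoise P (fun t ω => (E t ω).vec))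
    {A : Matrix (Fin q × Fin p) (Fin q × Fin p) ℝ} (hA : HasGeometricPowers A)
    {G : Matrix (Fin q × Fin p) (Fin n × Fin m) ℝ}
    (hG : ∃ H : Matrix (Fin n × Fin m) (Fin q × Fin p) ℝ, G * H = 1) :
    ∃ (Y : ℤ → Ω → Matrix (Fin p) (Fin q) ℝ) (ρ : ℝ),
      IsMatrixIntegratedOfOrderZero P E Y ∧ 0 ≤ ρ ∧ ρ < 1 ∧
      (∀ V : ℤ → Ω → Matrix (Fin p) (Fin q) ℝ,
        (∀ t, ∀ᵐ ω ∂P, (V t ω).vec = A *ᵥ (V (t - 1) ω).vec + G *ᵥ (E t ω).vec) →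
        HasSubexponentialPast P V → IsMatrixIntegratedOfOrderZero P E V) ∧
      ∀ V : ℕ → Ω → Matrix (Fin p) (Fin q) ℝ,
        (∀ t : ℕ, ∀ᵐ ω ∂P,
          (V (t + 1) ω).vec = A *ᵥ (V t ω).vec + G *ᵥ (E ((t : ℤ) + 1) ω).vec) →
        MergesExponentially P ρ V Y ∧
        ((∀ᵐ ω ∂P, V 0 ω = Y 0 ω) → ∀ t : ℕ, ∀ᵐ ω ∂P, V t ω = Y t ω) := by
  obtain ⟨H, hGH⟩ := hG
  obtain ⟨y, hy, hrec, huniq⟩ := exists_stationary_solution hE hA hGH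
  obtain ⟨K, ρ, h0, h1, hK⟩ := hA
  -- The indices are swapped because `vec` stacks columns and is indexed by (column, row).
  refine ⟨fun t ω => Matrix.of fun i j => y t ω (j, i), ρ, hy, h0, h1, fun V hV hpast => ?_,
    fun V hV => ?_⟩
  · refine IsIntegratedOfOrderZero.congr hy (huniq _ hV ?_)
    filter_upwards [hpast] with ω hω a
    exact hω a.2 a.1
  -- The innovations cancel pathwise, so nothing is needed of the law of the initial value.
  have hsub : ∀ᵐ ω ∂P, ∀ t : ℕ, (V t ω).vec - y t ω = A ^ t *ᵥ ((V 0 ω).vec - y 0 ω) := by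
    filter_upwards [ae_all_iff.2 hV, ae_all_iff.2 hrec] with ω h2 h3
    refine autoregression_sub_iterate (w := fun t => (V t ω).vec) (y := fun t : ℕ => y t ω)
      (u := fun t : ℕ => G *ᵥ (E ((t : ℤ) + 1) ω).vec) h2 fun t => ?_
    simpa using h3 ((t : ℤ) + 1)
  constructor
  · filter_upwards [hsub] with ω hω
    refine ⟨K * ∑ b, |((V 0 ω).vec - y 0 ω) b|, fun t i j => ?_⟩
    have h4 := congrFun (hω t) (j, i)
    rw [Pi.sub_apply] at h4
    change |(V t ω).vec (j, i) - y t ω (j, i)| ≤ _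
    rw [h4, Matrix.mulVec, dotProduct]
    refine (Finset.abs_sum_le_sum_abs _ _).trans ?_
    rw [mul_right_comm, Finset.mul_sum]
    refine Finset.sum_le_sum fun b _ => ?_
    rw [abs_mul]
    exact mul_le_mul_of_nonneg_right (hK t _ b) (abs_nonneg _)
  · intro hV0 t
    filter_upwards [hsub, hV0] with ω hω h2
    have h3 : (V 0 ω).vec - y 0 ω = 0 := by
      rw [h2]
      exact sub_self (y 0 ω)
    have h4 := hω t
    rw [h3, Matrix.mulVec_zero] at h4
    ext i j
    exact sub_eq_zero.1 (congrFun h4 (j, i))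

variable {m n r₁ r₂ : ℕ} {τ γ : Matrix (Fin m) (Fin r₁) ℝ} {φ θ : Matrix (Fin n) (Fin r₂) ℝ}
  {X₀ X₁ e : Matrix (Fin m) (Fin n) ℝ}

theorem ECCMARStep.eq_mul (h : ECCMARStep τ γ φ θ X₀ X₁ e) :
    X₁ = (1 + τ * γᵀ) * X₀ * (1 + φ * θᵀ)ᵀ + e := by
  rw [eq_add_of_sub_eq h]
  simp only [Matrix.transpose_add, Matrix.transpose_one, Matrix.transpose_mul,
    Matrix.transpose_transpose, Matrix.add_mul, Matrix.mul_add, Matrix.one_mul, Matrix.mul_one,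
    Matrix.mul_assoc]
  abel

theorem ECCMARStep.vec_row_error (h : ECCMARStep τ γ φ θ X₀ X₁ e) :
    (γᵀ * X₁).vec = ((1 + φ * θᵀ) ⊗ₖ (1 + γᵀ * τ)) *ᵥ (γᵀ * X₀).vec
      + ((1 : Matrix (Fin n) (Fin n) ℝ) ⊗ₖ γᵀ) *ᵥ e.vec := by
  rw [Matrix.kronecker_mulVec_vec, Matrix.kronecker_mulVec_vec, ← Matrix.vec_add, h.eq_mul]
  simp only [Matrix.transpose_one, Matrix.add_mul, Matrix.mul_add, Matrix.one_mul, Matrix.mul_one,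
    Matrix.mul_assoc]

theorem ECCMARStep.vec_column_error (h : ECCMARStep τ γ φ θ X₀ X₁ e) :
    (X₁ * θ).vec = ((1 + θᵀ * φ) ⊗ₖ (1 + τ * γᵀ)) *ᵥ (X₀ * θ).vec
      + (θᵀ ⊗ₖ (1 : Matrix (Fin m) (Fin m) ℝ)) *ᵥ e.vec := by
  rw [Matrix.kronecker_mulVec_vec, Matrix.kronecker_mulVec_vec, ← Matrix.vec_add, h.eq_mul]
  simp only [Matrix.transpose_one, Matrix.transpose_add, Matrix.transpose_mul,
    Matrix.transpose_transpose, Matrix.add_mul, Matrix.mul_add, Matrix.one_mul, Matrix.mul_one,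
    Matrix.mul_assoc]

theorem kronecker_mul_kronecker_eq_one {ι₁ ι₂ κ₁ κ₂ : Type*} [Fintype ι₁] [Fintype ι₂] [Fintype κ₁]
    [Fintype κ₂] [DecidableEq ι₁] [DecidableEq ι₂] {A : Matrix ι₁ κ₁ ℝ} {B : Matrix κ₁ ι₁ ℝ}
    {C : Matrix ι₂ κ₂ ℝ} {D : Matrix κ₂ ι₂ ℝ} (h : A * B = 1) (h' : C * D = 1) :
    (A ⊗ₖ C) * (B ⊗ₖ D) = 1 := by
  rw [← Matrix.mul_kronecker_mul, h, h', Matrix.one_kronecker_one]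

theorem HasSubexponentialPast.mul_left {X : ℤ → Ω → Matrix (Fin m) (Fin n) ℝ}
    (hX : HasSubexponentialPast P X) {p : ℕ} (B : Matrix (Fin p) (Fin m) ℝ) :
    HasSubexponentialPast P fun t ω => B * X t ω := by
  filter_upwards [hX] with ω hω i j r hr
  simp only [Matrix.mul_apply]
  exact Asymptotics.IsBigO.fun_sum fun k _ => (hω k j r hr).const_mul_left _

theorem HasSubexponentialPast.mul_right {X : ℤ → Ω → Matrix (Fin m) (Fin n) ℝ}
    (hX : HasSubexponentialPast P X) {p : ℕ} (B : Matrix (Fin n) (Fin p) ℝ) :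
    HasSubexponentialPast P fun t ω => X t ω * B := by
  filter_upwards [hX] with ω hω i j r hr
  simp only [Matrix.mul_apply, mul_comm _ (B _ _)]
  exact Asymptotics.IsBigO.fun_sum fun k _ => (hω i k r hr).const_mul_left _

end MatrixAutoregression

theorem mainTheorem2 {Ω : Type*} [MeasurableSpace Ω] (P : Measure Ω) [IsProbabilityMeasure P]
    {m n r₁ r₂ : ℕ}
    (Λ : Matrix (Fin m) (Fin m) ℝ) (Ψ : Matrix (Fin n) (Fin n) ℝ)
    (hΛ : HasSemisimpleUnitRoots Λ r₁) (hΨ : HasSemisimpleUnitRoots Ψ r₂)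
    (τ γ : Matrix (Fin m) (Fin r₁) ℝ) (φ θ : Matrix (Fin n) (Fin r₂) ℝ)
    (hτ : τ.rank = r₁) (hγ : γ.rank = r₁) (hφ : φ.rank = r₂) (hθ : θ.rank = r₂)
    (hΛfac : Λ = 1 + τ * γᵀ) (hΨfac : Ψ = 1 + φ * θᵀ)
    (E : ℤ → Ω → Matrix (Fin m) (Fin n) ℝ)
    (hE : IsWhiteNoise P (fun t ω => (E t ω).vec)) :
    -- the model on the time axis `ℤ`
    (∀ X : ℤ → Ω → Matrix (Fin m) (Fin n) ℝ,
      (∀ t, ∀ᵐ ω ∂P, ECCMARStep τ γ φ θ (X (t - 1) ω) (X t ω) (E t ω)) →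
      HasSubexponentialPast P X →
        IsMatrixIntegratedOfOrderZero P E (fun t ω => γᵀ * X t ω) ∧
        IsMatrixIntegratedOfOrderZero P E (fun t ω => X t ω * θ)) ∧
    -- the model started at time `0` from an arbitrary initial value
    (∃ (Y : ℤ → Ω → Matrix (Fin r₁) (Fin n) ℝ) (Z : ℤ → Ω → Matrix (Fin m) (Fin r₂) ℝ) (ρ : ℝ),
      IsMatrixIntegratedOfOrderZero P E Y ∧ IsMatrixIntegratedOfOrderZero P E Z ∧
      0 ≤ ρ ∧ ρ < 1 ∧
      ∀ X : ℕ → Ω → Matrix (Fin m) (Fin n) ℝ,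
        (∀ t : ℕ, ∀ᵐ ω ∂P,
          ECCMARStep τ γ φ θ (X t ω) (X (t + 1) ω) (E ((t : ℤ) + 1) ω)) →
        MergesExponentially P ρ (fun t ω => γᵀ * X t ω) Y ∧
        MergesExponentially P ρ (fun t ω => X t ω * θ) Z ∧
        ((∀ᵐ ω ∂P, γᵀ * X 0 ω = Y 0 ω) → ∀ t : ℕ, ∀ᵐ ω ∂P, γᵀ * X t ω = Y t ω) ∧
        ((∀ᵐ ω ∂P, X 0 ω * θ = Z 0 ω) → ∀ t : ℕ, ∀ᵐ ω ∂P, X t ω * θ = Z t ω)) := by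
  have hM := (hΛfac ▸ hΛ).hasGeometricPowers
  have hN := (hΨfac ▸ hΨ).hasGeometricPowers
  have hΛb := bounded_pow_of_hasGeometricPowers rfl hM
  have hΨb := bounded_pow_of_hasGeometricPowers rfl hN
  obtain ⟨Hγ, hHγ⟩ := exists_right_inverse_of_rank γ hγ
  obtain ⟨Hθ, hHθ⟩ := exists_right_inverse_of_rank θ hθ
  obtain ⟨Y, ρ₁, hY, h0, h1, hYpast, hYfut⟩ := exists_stationary_matrix_solution hE
    (HasGeometricPowers.kronecker_right hΨb hM)
    ⟨_, kronecker_mul_kronecker_eq_one (one_mul 1) hHγ⟩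
  obtain ⟨Z, ρ₂, hZ, h0', h1', hZpast, hZfut⟩ := exists_stationary_matrix_solution hE
    (HasGeometricPowers.kronecker_left hN hΛb)
    ⟨_, kronecker_mul_kronecker_eq_one hHθ (one_mul 1)⟩
  refine ⟨fun X hX hpast => ⟨hYpast _ (fun t => ?_) (hpast.mul_left γᵀ),
    hZpast _ (fun t => ?_) (hpast.mul_right θ)⟩, Y, Z, max ρ₁ ρ₂, hY, hZ, le_max_of_le_left h0,
    max_lt h1 h1', fun X hX => ?_⟩
  · filter_upwards [hX t] with ω hω using hω.vec_row_error
  · filter_upwards [hX t] with ω hω using hω.vec_column_error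
  obtain ⟨hY1, hY2⟩ := hYfut (fun t ω => γᵀ * X t ω) fun t => by
    filter_upwards [hX t] with ω hω using hω.vec_row_error
  obtain ⟨hZ1, hZ2⟩ := hZfut (fun t ω => X t ω * θ) fun t => by
    filter_upwards [hX t] with ω hω using hω.vec_column_error
  exact ⟨hY1.mono h0 (le_max_left _ _), hZ1.mono h0' (le_max_right _ _), hY2, hZ2⟩
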